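/- A *triangulation* $\Gamma$ of a connected closed surface $M$ (not necessarily orientable) is an embedding in $M$ of a finite connected simple graph whose faces are closed discs bounded by triangles, such that two distinct faces meet in an edge, in a vertex or not at all; every edge then lies in exactly two faces. (Equivalently, it is a homeomorphism from the geometric realization of a finite two-dimensional simplicial complex onto $M$.) Two edges are *adjacent* if they are distinct and lie in a common face, and two faces are *adjacent* if they are distinct and their intersection is an edge. A *zigzag* is a sequence of edges $(e_i)$ such that, for all $i$, the edges $e_i$ and $e_{i+1}$ are adjacent, the faces containing $e_i,e_{i+1}$ and $e_{i+1},e_{i+2}$ are adjacent, and $e_i$, $e_{i+2}$ are disjoint. Such a sequence is periodic, and zigzags are regarded as cyclic sequences (over the least period). A *$z$-orientation* $\tau$ of $\Gamma$ is a set of zigzags containing exactly one of $Z$ and its reverse $Z^{-1}$ for every zigzag $Z$. The zigzags of $\tau$ pass through each edge exactly twice in total; the edge is of *type I* if the two passages are in opposite directions, and of *type II* if they are in the same direction, in which case the edge is directed that way. A face is of *type II* if its three edges are of type II and form a directed cycle; every other face is of *type I* (it then has two edges of type I and one of type II). Let $n(v,w)$ be $1$ if $vw$ is an edge of type I, $2$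 if $vw$ is an edge of type II directed from $v$ to $w$, and $0$ otherwise. The Markov chain $\mathcal X_\tau$ is the time-homogeneous Markov chain whose states are the vertices of $\Gamma$ and whose transition probabilities are $p_{vw}=n(v,w)/\sum_u n(v,u)$. It is *ergodic* if it is irreducible and aperiodic, i.e. if every state can be reached from every state and, for each state $v$, the greatest common divisor of the lengths of the closed walks at $v$ in the transition graph is $1$. **Theorem.** Let $\tau$ be a $z$-orientation of a triangulation $\Gamma$ of a connected closed surface $M$. (1) The Markov chain $\mathcal X_\tau$ is not ergodic if and only if the graph of $\Gamma$ is $3$-colorable and all faces of $(\Gamma,\tau)$ are of type II. (2) If $M$ is homeomorphic to the sphere or to the real projective plane, then $\mathcal X_\tau$ is not ergodic if and only if all faces of $(\Gamma,\tau)$ are of type II. -/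

import Mathlib

/-! ### Triangulated closed surfaces -/

section Complexes

variable {V : Type*} [DecidableEq V]

/-- The graph formed by the vertices and edges of a family of triangles: two distinct vertices are
joined when some triangle contains both. -/
def edgeGraph (faces : Finset (Finset V)) : SimpleGraph V where
  Adj v w := v ≠ w ∧ ∃ F ∈ faces, v ∈ F ∧ w ∈ F
  symm := ⟨fun _ _ h => ⟨h.1.symm, h.2.imp fun _ hF => ⟨hF.1, hF.2.2, hF.2.1⟩⟩⟩
  loopless := ⟨fun _ h => h.1 rfl⟩

/-- The link of the vertex `v` in a family of triangles: `x` and `y` are joined when `v`, `x`, `y`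
are the vertices of a triangle. -/
def linkGraph (faces : Finset (Finset V)) (v : V) : SimpleGraph V where
  Adj x y := x ≠ y ∧ ({v, x, y} : Finset V) ∈ faces
  symm := ⟨fun x y h => ⟨h.1.symm, by
    rw [show ({v, y, x} : Finset V) = {v, x, y} by ext; simp; tauto]; exact h.2⟩⟩
  loopless := ⟨fun _ h => h.1 rfl⟩

/-- The geometric realization of a family of triangles on a finite vertex set, in barycentric
coordinates, with the topology induced from `V → ℝ`. -/
def realization [Fintype V] (faces : Finset (Finset V)) : Set (V → ℝ) :=
  {x | (∀ v, 0 ≤ x v) ∧ ∑ v, x v = 1 ∧ ∃ F ∈ faces, ∀ v, v ∉ F → x v = 0}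

/-- A finite pure two-dimensional simplicial complex, given by its set of triangles, that is a
connected closed surface (not necessarily orientable): every edge lies in precisely two triangles,
and the triangles around each vertex form a single cycle (every vertex of a link has degree two by
the condition on edges, so a connected link is a cycle). -/
structure SimplicialSurface (V : Type*) [DecidableEq V] where
  /-- the triangles, each given by its set of vertices -/
  faces : Finset (Finset V)
  card_face : ∀ F ∈ faces, F.card = 3
  exists_face : ∀ v : V, ∃ F ∈ faces, v ∈ F
  edge_two_faces : ∀ v w : V, (edgeGraph faces).Adj v w →
    (faces.filter fun F => v ∈ F ∧ w ∈ F).card = 2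
  link_connected : ∀ v x y : V, (edgeGraph faces).Adj v x → (edgeGraph faces).Adj v y →
    (linkGraph faces v).Reachable x y
  connected : (edgeGraph faces).Connected

/-- A triangulation, with vertex set `V`, of the surface `M`: a simplicial surface together with a
homeomorphism from its geometric realization onto `M`. (So `M` is automatically a connected closed
surface.) -/
structure Triangulation (V : Type*) [DecidableEq V] [Fintype V]
    (M : Type*) [TopologicalSpace M] extends SimplicialSurface V where
  homeo : realization faces ≃ₜ M

end Complexes

/-! ### Zigzags and z-orientations -/

namespace SimplicialSurface

variable {V : Type*} [DecidableEq V] (S : SimplicialSurface V)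

/-- The underlying graph. -/
abbrev graph : SimpleGraph V := edgeGraph S.faces

/-- `e` is the set of the two ends of an edge. -/
def IsEdge (e : Finset V) : Prop := e.card = 2 ∧ ∃ F ∈ S.faces, e ⊆ F

/-- Two edges are adjacent if they are distinct and contained in a common face. -/
def AdjEdges (e e' : Finset V) : Prop := e ≠ e' ∧ ∃ F ∈ S.faces, e ⊆ F ∧ e' ⊆ F

/-- Two faces are adjacent if they are distinct and their intersection is an edge. -/
def AdjFaces (F F' : Finset V) : Prop := F ≠ F' ∧ S.IsEdge (F ∩ F')

/-- A zigzag, written as a sequence of edges. Since the sequence is periodic in both directions, it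
is indexed by the integers. -/
structure IsZigzag (Z : ℤ → Finset V) : Prop where
  isEdge : ∀ i, S.IsEdge (Z i)
  adj : ∀ i, S.AdjEdges (Z i) (Z (i + 1))
  faces_adj : ∀ i, ∃ F ∈ S.faces, ∃ F' ∈ S.faces, S.AdjFaces F F' ∧
    Z i ⊆ F ∧ Z (i + 1) ⊆ F ∧ Z (i + 1) ⊆ F' ∧ Z (i + 2) ⊆ F'
  disjoint : ∀ i, Disjoint (Z i) (Z (i + 2))

/-- Zigzags with a chosen position `0`. -/
def ZigzagSeq : Type _ := {Z : ℤ → Finset V // S.IsZigzag Z}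

/-- Two sequences present the same cyclic sequence if they differ by a shift of the index. -/
instance zigzagSetoid : Setoid S.ZigzagSeq where
  r Z Z' := ∃ k : ℤ, ∀ i, Z'.1 i = Z.1 (i + k)
  iseqv :=
    { refl := fun _ => ⟨0, fun i => by simp⟩
      symm := fun {_ _} ⟨k, h⟩ => ⟨-k, fun i => by rw [h]; simp⟩
      trans := fun {_ _ _} ⟨k, h⟩ ⟨l, h'⟩ =>
        ⟨l + k, fun i => by rw [h', h, add_assoc]⟩ }

/-- Zigzags as cyclic sequences of edges. -/
def Zigzag : Type _ := Quotient S.zigzagSetoid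

variable {S}

/-- The reversed sequence. -/
def ZigzagSeq.reverse (Z : S.ZigzagSeq) : S.ZigzagSeq :=
  ⟨fun i => Z.1 (-i),
    { isEdge := fun i => Z.2.isEdge (-i)
      adj := fun i => by
        obtain ⟨hne, F, hF, h1, h2⟩ := Z.2.adj (-(i + 1))
        rw [show -(i + 1) + 1 = -i by ring] at hne h2
        exact ⟨hne.symm, F, hF, h2, h1⟩
      faces_adj := fun i => by
        obtain ⟨F, hF, F', hF', ⟨hne, hE⟩, h1, h2, h3, h4⟩ := Z.2.faces_adj (-(i + 2))
        rw [show -(i + 2) + 1 = -(i + 1) by ring] at h2 h3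
        rw [show -(i + 2) + 2 = -i by ring] at h4
        exact ⟨F', hF', F, hF, ⟨hne.symm, by rwa [Finset.inter_comm]⟩, h4, h3, h2, h1⟩
      disjoint := fun i => by
        have h := Z.2.disjoint (-(i + 2))
        rw [show -(i + 2) + 2 = -i by ring] at h
        exact h.symm }⟩

/-- The reversed zigzag. -/
def Zigzag.reverse : S.Zigzag → S.Zigzag :=
  Quotient.map ZigzagSeq.reverse fun Z Z' ⟨k, h⟩ => ⟨-k, fun i => by
    change Z'.1 (-i) = Z.1 (-(i + -k))
    rw [h, neg_add, neg_neg]⟩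

/-- A z-orientation contains precisely one zigzag from each pair of mutually reversed zigzags. -/
def IsZOrientation (τ : Set S.Zigzag) : Prop :=
  ∀ Z : S.Zigzag, Xor (Z ∈ τ) (Z.reverse ∈ τ)

/-- The passages of the zigzags from `τ` through the edge `vw` in the direction from `v` to `w`.
A passage is an occurrence of the edge in a cyclic sequence from `τ`, that is, such a sequence
presented so that this occurrence has index `0`; it goes from the common end `v` with the preceding
edge to the common end `w` with the following edge. -/
def passages (τ : Set S.Zigzag) (v w : V) : Set S.ZigzagSeq :=
  {Z | (⟦Z⟧ : S.Zigzag) ∈ τ ∧ Z.1 0 = {v, w} ∧ v ∈ Z.1 (-1) ∧ w ∈ Z.1 1}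

/-- `vw` is an edge of type I: it is passed twice, in opposite directions. -/
def EdgeTypeI (τ : Set S.Zigzag) (v w : V) : Prop :=
  S.graph.Adj v w ∧ (passages τ v w).ncard = 1 ∧ (passages τ w v).ncard = 1

/-- `vw` is an edge of type II directed from `v` to `w`: it is passed twice, both times from `v`
to `w`. -/
def EdgeTypeII (τ : Set S.Zigzag) (v w : V) : Prop :=
  S.graph.Adj v w ∧ (passages τ v w).ncard = 2 ∧ passages τ w v = ∅

/-- A face is of type II if its edges are of type II and form a directed cycle. -/
def FaceTypeII (τ : Set S.Zigzag) (F : Finset V) : Prop :=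
  ∃ a b c : V, F = {a, b, c} ∧ EdgeTypeII τ a b ∧ EdgeTypeII τ b c ∧ EdgeTypeII τ c a

open Classical in
/-- The number of directed edges from `v` to `w` after each edge of type I is replaced with two
oppositely directed edges and each edge of type II with two edges in its direction. -/
noncomputable def arcs (τ : Set S.Zigzag) (v w : V) : ℕ :=
  if EdgeTypeI τ v w then 1 else if EdgeTypeII τ v w then 2 else 0

/-- The transition matrix of the Markov chain of a z-oriented triangulation: the probability of
going from `v` to `w` is the number of directed edges from `v` to `w` over the outdegree of `v`. -/
noncomputable def transitionMatrix [Fintype V] (τ : Set S.Zigzag) : Matrix V V ℝ :=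
  fun v w => (arcs τ v w : ℝ) / ∑ u, (arcs τ v u : ℝ)

end SimplicialSurface

/-! ### Ergodic finite Markov chains -/

/-- The period of the state `v` of a Markov chain with transition matrix `P`: the greatest common
divisor of the lengths of all closed walks at `v` in the transition graph. -/
noncomputable def period {V : Type*} [Fintype V] [DecidableEq V] (P : Matrix V V ℝ) (v : V) : ℕ :=
  Nat.setGcd {n : ℕ | 0 < (P ^ n) v v}

/-- A finite time-homogeneous Markov chain, given by its transition matrix, is ergodic if it is
irreducible and aperiodic. -/
def IsErgodicChain {V : Type*} [Fintype V] [DecidableEq V] (P : Matrix V V ℝ) : Prop :=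
  P.IsIrreducible ∧ ∀ v, period P v = 1

/-! ### The sphere and the real projective plane -/

/-- The two-dimensional sphere. -/
abbrev TwoSphere : Type := Metric.sphere (0 : EuclideanSpace ℝ (Fin 3)) 1

/-- Antipodal points of the sphere are identified. -/
def antipodalSetoid : Setoid TwoSphere where
  r x y := x = y ∨ x = -y
  iseqv :=
    { refl := fun _ => Or.inl rfl
      symm := fun {_ _} h => h.elim (fun h => Or.inl h.symm) fun h => Or.inr (by rw [h, neg_neg])
      trans := fun {_ _ _} h h' => by
        rcases h with rfl | rfl <;> rcases h' with rfl | rfl <;> simp }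

/-- The real projective plane, with the quotient topology. -/
abbrev ProjectivePlane : Type := Quotient antipodalSetoid

namespace SimplicialSurface

/-! ### Flags (ordered triangles) and zigzags as orbits of a permutation -/

section Flags

variable {V : Type*} [DecidableEq V] {S : SimplicialSurface V}

/-! Two consecutive edges `ab`, `bc` of a zigzag determine it, so zigzags are the orbits of a
permutation `step` on flags `abc`, and a z-orientation chooses one flag from each pair `abc`, `cba`,
consistently along orbits. Every orbit is finite, so each arc lies on a closed walk; as the graph is
connected, the chain is always irreducible and only its period matters.

A face of type I carries directed cycles of lengths two and three through one vertex, which forces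
period one. If all faces are of type II, every vertex lies on a directed triangle and the period is
1 or 3. It is 3 precisely when some labelling of the vertices in `ZMod 3` increases by one along
each arc; this is `not_isErgodicChain_iff`.

Such a labelling is a 3-coloring. Conversely, a 3-coloring changes by the same sign along the three
arcs of a directed triangle; the sign is constant around each link, hence everywhere, so the
coloring or its negative is a labelling.

In part (2) the cochain equal to 1 on each arc is a 1-cocycle modulo three, because each triangle is
a directed cycle. A labelling is a primitive of it, and H¹ of the sphere or the projective plane
with coefficients in `ZMod 3` vanishes. This is proved with Čech cocycles on the cover by open
stars: the sphere is glued from two stereographic charts, and the projective plane is treated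
through its double cover, using that `ZMod 3` has no 2-torsion. -/

theorem ne_of_face {a b c : V} (h : {a, b, c} ∈ S.faces) : a ≠ b ∧ b ≠ c ∧ a ≠ c := by
  have h3 := S.card_face _ h
  refine ⟨?_, ?_, ?_⟩ <;> rintro rfl
  · have := Finset.card_le_two (a := a) (b := c)
    simp_all
  · have := Finset.card_le_two (a := a) (b := b)
    simp_all
  · have := Finset.card_le_two (a := a) (b := b)
    rw [show ({a, b, a} : Finset V) = {a, b} by ext; simp; tauto] at h3
    omega

theorem face_rotate {a b c : V} (h : {a, b, c} ∈ S.faces) : {b, c, a} ∈ S.faces := by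
  rwa [show ({b, c, a} : Finset V) = {a, b, c} by ext; simp; tauto]

theorem face_reverse {a b c : V} (h : {a, b, c} ∈ S.faces) : {c, b, a} ∈ S.faces := by
  rwa [show ({c, b, a} : Finset V) = {a, b, c} by ext; simp; tauto]

theorem face_swap {a b c : V} (h : {a, b, c} ∈ S.faces) : {b, a, c} ∈ S.faces := by
  rwa [show ({b, a, c} : Finset V) = {a, b, c} by ext; simp; tauto]

theorem face_eq_insert {F : Finset V} (hF : F ∈ S.faces) {a b : V} (hab : a ≠ b) (ha : a ∈ F)
    (hb : b ∈ F) : ∃ c, F = {a, b, c} := by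
  obtain ⟨x, y, z, hxy, hxz, hyz, rfl⟩ := Finset.card_eq_three.1 (S.card_face F hF)
  have key : ∀ c ∈ ({x, y, z} : Finset V), a ≠ c → b ≠ c →
      ({x, y, z} : Finset V) = {a, b, c} := by
    intro c hc hac hbc
    refine (Finset.eq_of_subset_of_card_le ?_ ?_).symm
    · intro t ht
      simp only [Finset.mem_insert, Finset.mem_singleton] at ht
      rcases ht with rfl | rfl | rfl <;> assumption
    · rw [Finset.card_eq_three.2 ⟨x, y, z, hxy, hxz, hyz, rfl⟩,
        Finset.card_eq_three.2 ⟨a, b, c, hab, hac, hbc, rfl⟩]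
  simp only [Finset.mem_insert, Finset.mem_singleton] at ha hb
  rcases ha with rfl | rfl | rfl <;> rcases hb with rfl | rfl | rfl <;>
    first
    | exact absurd rfl hab
    | exact ⟨x, key x (by simp) (Ne.symm (by assumption)) (Ne.symm (by assumption))⟩
    | exact ⟨y, key y (by simp) (by assumption) (by assumption)⟩
    | exact ⟨z, key z (by simp) (by assumption) (by assumption)⟩
    | exact ⟨y, key y (by simp) (Ne.symm (by assumption)) (by assumption)⟩
    | exact ⟨y, key y (by simp) (by assumption) (Ne.symm (by assumption))⟩

theorem apex_unique {a b c d : V} (h : {a, b, c} ∈ S.faces)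
    (e : ({a, b, c} : Finset V) = {a, b, d}) :
    c = d := by
  obtain ⟨-, h2, h3⟩ := ne_of_face h
  have : c ∈ ({a, b, d} : Finset V) := by rw [← e]; simp
  simp only [Finset.mem_insert, Finset.mem_singleton] at this
  rcases this with rfl | rfl | rfl
  · exact absurd rfl h3
  · exact absurd rfl h2
  · rfl

theorem graph_adj_of_face {a b c : V} (h : {a, b, c} ∈ S.faces) : S.graph.Adj a b :=
  ⟨(ne_of_face h).1, _, h, by simp, by simp⟩

theorem exists_face_of_adj {a b : V} (h : S.graph.Adj a b) : ∃ c, {a, b, c} ∈ S.faces := by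
  obtain ⟨hne, F, hF, ha, hb⟩ := h
  obtain ⟨c, rfl⟩ := face_eq_insert hF hne ha hb
  exact ⟨c, hF⟩

/-- Besides `abc` there is precisely one triangle that contains the edge `ab`. -/
theorem exists_opposite {a b c : V} (h : {a, b, c} ∈ S.faces) :
    ∃ d, d ≠ c ∧ {a, b, d} ∈ S.faces ∧ ∀ x, {a, b, x} ∈ S.faces → x = c ∨ x = d := by
  obtain ⟨hab, hbc, hac⟩ := ne_of_face h
  obtain ⟨F, G, hFG, hfil⟩ := Finset.card_eq_two.1 (S.edge_two_faces a b (graph_adj_of_face h))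
  have mem : ∀ x, {a, b, x} ∈ S.faces → ({a, b, x} : Finset V) = F ∨ {a, b, x} = G := by
    intro x hx
    have : ({a, b, x} : Finset V) ∈ S.faces.filter fun F => a ∈ F ∧ b ∈ F := by simp [hx]
    rw [hfil] at this
    simpa using this
  have hF : F ∈ S.faces.filter fun F => a ∈ F ∧ b ∈ F := by rw [hfil]; simp
  have hG : G ∈ S.faces.filter fun F => a ∈ F ∧ b ∈ F := by rw [hfil]; simp
  simp only [Finset.mem_filter] at hF hG
  obtain ⟨f, rfl⟩ := face_eq_insert hF.1 hab hF.2.1 hF.2.2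
  obtain ⟨g, rfl⟩ := face_eq_insert hG.1 hab hG.2.1 hG.2.2
  have key : ∀ x, {a, b, x} ∈ S.faces → x = f ∨ x = g := fun x hx =>
    (mem x hx).imp (apex_unique hx) (apex_unique hx)
  have hfg : f ≠ g := fun e => hFG (by rw [e])
  rcases key c h with rfl | rfl
  · exact ⟨g, hfg.symm, hG.1, key⟩
  · exact ⟨f, hfg, hF.1, fun x hx => (key x hx).symm⟩

variable (S) in
/-- A triangle with a linear order of its vertices. -/
@[ext] structure Flag where
  /-- the first vertex -/
  a : V
  /-- the second vertex -/
  b : V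
  /-- the third vertex -/
  c : V
  mem : {a, b, c} ∈ S.faces

instance [Finite V] : Finite S.Flag :=
  Finite.of_injective (fun t : S.Flag => (t.a, t.b, t.c)) fun t t' h => by
    simp only [Prod.mk.injEq] at h
    exact Flag.ext h.1 h.2.1 h.2.2

/-- The triangle `abc` is followed by the other triangle `bcd` on the edge `bc`. -/
noncomputable def Flag.next (t : S.Flag) : S.Flag :=
  ⟨t.b, t.c, (exists_opposite (face_rotate t.mem)).choose,
    (exists_opposite (face_rotate t.mem)).choose_spec.2.1⟩

theorem Flag.next_a (t : S.Flag) : t.next.a = t.b := rfl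

theorem Flag.next_b (t : S.Flag) : t.next.b = t.c := rfl

theorem Flag.next_c_ne (t : S.Flag) : t.next.c ≠ t.a :=
  (exists_opposite (face_rotate t.mem)).choose_spec.1

theorem Flag.next_mem (t : S.Flag) : {t.b, t.c, t.next.c} ∈ S.faces := t.next.mem

theorem Flag.next_eq (t : S.Flag) {x : V} (hx : {t.b, t.c, x} ∈ S.faces) (h : x ≠ t.a) :
    t.next = ⟨t.b, t.c, x, hx⟩ :=
  Flag.ext rfl rfl
    (((exists_opposite (face_rotate t.mem)).choose_spec.2.2 x hx).resolve_left h).symm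

/-- The reversed order of the vertices. -/
def Flag.rev (t : S.Flag) : S.Flag := ⟨t.c, t.b, t.a, face_reverse t.mem⟩

/-- Reversal conjugates `next` to its inverse. Injectivity of `next` follows, and bijectivity when
there are finitely many flags. -/
theorem Flag.next_rev_next (t : S.Flag) : t.next.rev.next = t.rev :=
  Flag.next_eq _ (face_reverse t.mem) t.next_c_ne.symm

theorem Flag.next_injective : Function.Injective (Flag.next : S.Flag → S.Flag) := by
  intro t t' h
  have := congrArg (fun t => t.rev.next) h
  simp only [Flag.next_rev_next] at this
  exact congrArg Flag.rev this

variable [Finite V]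

/-- The step from a triangle to the following one along a zigzag, as a permutation. -/
noncomputable def step : Equiv.Perm S.Flag :=
  Equiv.ofBijective Flag.next (Finite.injective_iff_bijective.1 Flag.next_injective)

theorem step_apply (t : S.Flag) : step t = t.next := rfl

theorem step_zpow_add_one (t : S.Flag) (i : ℤ) : (step ^ (i + 1)) t = ((step ^ i) t).next := by
  rw [add_comm, zpow_add, zpow_one]; rfl

theorem step_zpow_next (t : S.Flag) (i : ℤ) : (step ^ i) t.next = (step ^ (i + 1)) t := by
  rw [zpow_add, zpow_one]; rfl

theorem step_pow_rev (n : ℕ) (t : S.Flag) : (step ^ n) ((step ^ n) t).rev = t.rev := by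
  induction n generalizing t with
  | zero => rfl
  | succ n ih =>
    have h : (step ^ (n + 1)) t = ((step ^ n) t).next := by rw [pow_succ']; rfl
    rw [h, pow_succ, Equiv.Perm.mul_apply, step_apply, Flag.next_rev_next, ih]

theorem step_zpow_rev (t : S.Flag) (i : ℤ) : (step ^ i) t.rev = ((step ^ (-i)) t).rev := by
  obtain ⟨n, rfl | rfl⟩ := i.eq_nat_or_neg
  · have h := step_pow_rev n ((step ^ (-(n : ℤ))) t)
    rw [zpow_neg, zpow_natCast, ← Equiv.Perm.mul_apply (step ^ n) (step ^ n)⁻¹, mul_inv_cancel,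
      Equiv.Perm.one_apply] at h
    rw [zpow_natCast, h, zpow_neg, zpow_natCast]
  · rw [neg_neg, zpow_neg, Equiv.Perm.inv_eq_iff_eq, zpow_natCast]
    exact (step_pow_rev n t).symm

theorem isZigzag_step (t : S.Flag) :
    S.IsZigzag fun i => {((step ^ i) t).a, ((step ^ i) t).b} := by
  have two : ∀ i : ℤ, i + 2 = i + 1 + 1 := fun i => by ring
  have facts : ∀ i : ℤ, ∃ a b c d, ((step ^ i) t).a = a ∧ ((step ^ i) t).b = b ∧
      ((step ^ (i + 1)) t).a = b ∧ ((step ^ (i + 1)) t).b = c ∧ ((step ^ (i + 2)) t).a = c ∧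
      ((step ^ (i + 2)) t).b = d ∧ {a, b, c} ∈ S.faces ∧ {b, c, d} ∈ S.faces ∧ d ≠ a := fun i => by
    simp only [two, step_zpow_add_one, Flag.next_a, Flag.next_b]
    exact ⟨_, _, _, _, rfl, rfl, rfl, rfl, rfl, rfl, Flag.mem _, Flag.next_mem _,
      Flag.next_c_ne _⟩
  refine ⟨fun i => ?_, fun i => ?_, fun i => ?_, fun i => ?_⟩ <;>
    obtain ⟨a, b, c, d, h1, h2, h3, h4, h5, h6, h, h', hne⟩ := facts i <;>
    simp only [h1, h2, h3, h4, h5, h6] <;>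
    obtain ⟨hab, hbc, hac⟩ := ne_of_face h <;> obtain ⟨-, hcd, hbd⟩ := ne_of_face h'
  · exact ⟨Finset.card_pair hab, _, h, by intro x; simp; tauto⟩
  · refine ⟨fun e => ?_, _, h, by intro x; simp; tauto, by intro x; simp; tauto⟩
    have : a ∈ ({b, c} : Finset V) := by rw [← e]; simp
    simp only [Finset.mem_insert, Finset.mem_singleton] at this
    tauto
  · refine ⟨_, h, _, h', ⟨fun e => ?_, ?_⟩, by intro x; simp; tauto, by intro x; simp; tauto,
      by intro x; simp; tauto, by intro x; simp; tauto⟩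
    · have : a ∈ ({b, c, d} : Finset V) := by rw [← e]; simp
      simp only [Finset.mem_insert, Finset.mem_singleton] at this
      tauto
    · rw [show ({a, b, c} ∩ {b, c, d} : Finset V) = {b, c} by
        ext x
        simp only [Finset.mem_inter, Finset.mem_insert, Finset.mem_singleton]
        constructor
        · rintro ⟨rfl | h | h, h'⟩ <;> tauto
        · tauto]
      exact ⟨Finset.card_pair hbc, _, h, by intro x; simp; tauto⟩
  · rw [Finset.disjoint_left]
    intro x hx hx'
    simp only [Finset.mem_insert, Finset.mem_singleton] at hx hx'
    rcases hx with rfl | rfl <;> rcases hx' with rfl | rfl <;> tauto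

/-- The zigzag that begins with the edges `ab` and `bc` of the triangle `abc`. -/
noncomputable def Flag.zigzag (t : S.Flag) : S.ZigzagSeq :=
  ⟨fun i => {((step ^ i) t).a, ((step ^ i) t).b}, isZigzag_step t⟩

theorem Flag.zigzag_add_one (t : S.Flag) (i : ℤ) :
    t.zigzag.1 (i + 1) = {((step ^ i) t).b, ((step ^ i) t).c} := by
  simp only [Flag.zigzag, step_zpow_add_one]; rfl

theorem Flag.zigzag_one (t : S.Flag) : t.zigzag.1 1 = {t.b, t.c} := t.zigzag_add_one 0

theorem Flag.mem_zigzag_neg_one (t : S.Flag) : t.a ∈ t.zigzag.1 (-1) := by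
  have h := step_zpow_add_one t (-1)
  rw [neg_add_cancel, zpow_zero, Equiv.Perm.one_apply] at h
  have : t.a = ((step ^ (-1 : ℤ)) t).b := congrArg Flag.a h
  simp [Flag.zigzag, this]

theorem Flag.mk_zigzag_next (t : S.Flag) : (⟦t.next.zigzag⟧ : S.Zigzag) = ⟦t.zigzag⟧ :=
  Quotient.sound ⟨-1, fun i => by
    simp only [Flag.zigzag, step_zpow_next, neg_add_cancel_right]⟩

theorem Flag.mk_zigzag_rev (t : S.Flag) :
    (⟦t.rev.zigzag⟧ : S.Zigzag) = Zigzag.reverse ⟦t.zigzag⟧ :=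
  -- The reversed flag starts with the edge `cb`, which has index 1 in the zigzag of `t`.
  Quotient.sound ⟨1, fun i => by
    change t.zigzag.1 (-i) = {((step ^ (i + 1)) t.rev).a, ((step ^ (i + 1)) t.rev).b}
    rw [step_zpow_rev, show -i = -(i + 1) + 1 by ring, t.zigzag_add_one]
    exact Finset.pair_comm _ _⟩

end Flags

/-! ### Passages, edge types and face types in terms of flags -/

section Passages

variable {V : Type*} [DecidableEq V] {S : SimplicialSurface V}

theorem exists_face_of_adjEdges {e e' : Finset V} (he : e.card = 2) (he' : e'.card = 2)
    (h : S.AdjEdges e e') : ∃ a b c, {a, b, c} ∈ S.faces ∧ e = {a, b} ∧ e' = {b, c} := by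
  obtain ⟨hne, F, hF, h1, h2⟩ := h
  obtain ⟨p, q, hpq, rfl⟩ := Finset.card_eq_two.1 he
  obtain ⟨r, rfl⟩ := face_eq_insert hF hpq (h1 (by simp)) (h1 (by simp))
  have hr : r ∈ e' := by
    by_contra hr
    refine hne (Finset.eq_of_subset_of_card_le (fun x hx => ?_) (by rw [he, he'])).symm
    have := h2 hx
    simp only [Finset.mem_insert, Finset.mem_singleton] at this ⊢
    rcases this with h | h | rfl
    exacts [.inl h, .inr h, absurd hx hr]
  obtain ⟨s, hs, hsr⟩ := Finset.exists_mem_ne (by omega : 1 < e'.card) r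
  have he'' : e' = {s, r} := by
    refine (Finset.eq_of_subset_of_card_le (fun x hx => ?_) ?_).symm
    · simp only [Finset.mem_insert, Finset.mem_singleton] at hx
      rcases hx with rfl | rfl <;> assumption
    · rw [he', Finset.card_pair hsr]
  have := h2 hs
  simp only [Finset.mem_insert, Finset.mem_singleton] at this
  rcases this with rfl | rfl | rfl
  · exact ⟨q, s, r, face_swap hF, Finset.pair_comm _ _, he''⟩
  · exact ⟨p, s, r, hF, rfl, he''⟩
  · exact absurd rfl hsr

/-- The third edge lies in the other face on `bc` and avoids `b`, being disjoint from `ab`; only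
`cd` is left. -/
theorem IsZigzag.apply_add_two {Z : ℤ → Finset V} (hZ : S.IsZigzag Z) {i : ℤ} {a b c d : V}
    (h : {a, b, c} ∈ S.faces) (h' : {b, c, d} ∈ S.faces) (hd : d ≠ a) (h0 : Z i = {a, b})
    (h1 : Z (i + 1) = {b, c}) : Z (i + 2) = {c, d} := by
  obtain ⟨F, hF, F', hF', ⟨hne, -⟩, k1, k2, k3, k4⟩ := hZ.faces_adj i
  have hdis := hZ.disjoint i
  rw [h0] at k1 hdis
  rw [h1] at k2 k3
  obtain ⟨-, hbc, hac⟩ := ne_of_face h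
  obtain ⟨a', rfl⟩ := face_eq_insert hF hbc (k2 (by simp)) (k2 (by simp))
  obtain ⟨d', rfl⟩ := face_eq_insert hF' hbc (k3 (by simp)) (k3 (by simp))
  have ha : a = a' := by
    have := k1 (show a ∈ ({a, b} : Finset V) by simp)
    have := (ne_of_face h).1
    simp_all
  subst ha
  have hd' : d' ≠ a := by rintro rfl; exact hne rfl
  obtain ⟨o, -, -, huniq⟩ := exists_opposite hF
  have : d' = d := ((huniq _ hF').resolve_left hd').trans ((huniq _ h').resolve_left hd).symm
  subst this
  refine Finset.eq_of_subset_of_card_le (fun x hx => ?_) ?_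
  · have hx' := k4 hx
    have hxb : x ≠ b := fun e => Finset.disjoint_left.1 hdis (by simp [e]) hx
    simp only [Finset.mem_insert, Finset.mem_singleton] at hx' ⊢
    tauto
  · rw [(hZ.isEdge _).1]
    exact Finset.card_le_two

theorem IsZigzag.eq_add_nat {Z Z' : ℤ → Finset V} (hZ : S.IsZigzag Z) (hZ' : S.IsZigzag Z') {i : ℤ}
    (h0 : Z i = Z' i) (h1 : Z (i + 1) = Z' (i + 1)) (n : ℕ) :
    Z (i + n) = Z' (i + n) ∧ Z (i + n + 1) = Z' (i + n + 1) := by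
  induction n with
  | zero => simpa using ⟨h0, h1⟩
  | succ n ih =>
    obtain ⟨e0, e1⟩ := ih
    push_cast
    rw [← add_assoc]
    refine ⟨e1, ?_⟩
    rw [show i + n + 1 + 1 = i + n + 2 by ring]
    obtain ⟨a, b, c, h, k0, k1⟩ :=
      exists_face_of_adjEdges (hZ.isEdge (i + n)).1 (hZ.isEdge (i + n + 1)).1 (hZ.adj (i + n))
    obtain ⟨d, hd, h', -⟩ := exists_opposite (face_rotate h)
    rw [hZ.apply_add_two h h' hd k0 k1, hZ'.apply_add_two h h' hd (e0 ▸ k0) (e1 ▸ k1)]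

theorem ZigzagSeq.ext_of_eq {Z Z' : S.ZigzagSeq} (h0 : Z.1 0 = Z'.1 0) (h1 : Z.1 1 = Z'.1 1) :
    Z = Z' := by
  apply Subtype.ext
  funext i
  obtain ⟨n, rfl | rfl⟩ := i.eq_nat_or_neg
  · simpa using (Z.2.eq_add_nat Z'.2 h0 (by simpa using h1) n).1
  -- The past of a zigzag is the future of its reverse, where the two known edges have indices -1
  -- and 0.
  · have := (Z.reverse.2.eq_add_nat Z'.reverse.2 (i := -1) (by simpa [ZigzagSeq.reverse] using h1)
      (by simpa [ZigzagSeq.reverse] using h0) n).2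
    simpa [ZigzagSeq.reverse] using this

theorem EdgeTypeII.arcs_pos {τ : Set S.Zigzag} {v w : V} (h : EdgeTypeII τ v w) : 0 < arcs τ v w := by
  unfold arcs
  split_ifs <;> simp

variable [Finite V]

/-- The zigzag through `ab`, `bc` in the triangle `abc` belongs to `τ`. -/
def Traverses (τ : Set S.Zigzag) (a b c : V) : Prop :=
  ∃ h : {a, b, c} ∈ S.faces, (⟦(⟨a, b, c, h⟩ : S.Flag).zigzag⟧ : S.Zigzag) ∈ τ

variable {τ : Set S.Zigzag}

theorem traverses_reverse_iff (hτ : IsZOrientation τ) {a b c : V} (h : {a, b, c} ∈ S.faces) :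
    Traverses τ c b a ↔ ¬ Traverses τ a b c := by
  have key := hτ ⟦(⟨a, b, c, h⟩ : S.Flag).zigzag⟧
  rw [← Flag.mk_zigzag_rev] at key
  have h1 : Traverses τ a b c ↔ (⟦(⟨a, b, c, h⟩ : S.Flag).zigzag⟧ : S.Zigzag) ∈ τ :=
    ⟨fun ⟨_, k⟩ => k, fun k => ⟨h, k⟩⟩
  have h2 : Traverses τ c b a ↔ (⟦(⟨a, b, c, h⟩ : S.Flag).rev.zigzag⟧ : S.Zigzag) ∈ τ :=
    ⟨fun ⟨_, k⟩ => k, fun k => ⟨face_reverse h, k⟩⟩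
  rw [h1, h2]
  unfold Xor at key
  tauto

theorem traverses_next_iff {a b c d : V} (h : {a, b, c} ∈ S.faces) (h' : {b, c, d} ∈ S.faces)
    (hd : d ≠ a) : Traverses τ b c d ↔ Traverses τ a b c := by
  have key := Flag.mk_zigzag_next (⟨a, b, c, h⟩ : S.Flag)
  rw [Flag.next_eq (⟨a, b, c, h⟩ : S.Flag) h' hd] at key
  exact ⟨fun ⟨_, k⟩ => ⟨h, key ▸ k⟩, fun ⟨_, k⟩ => ⟨h', key ▸ k⟩⟩

theorem exists_traverses_next {a b c : V} (h : Traverses τ a b c) : ∃ d, Traverses τ b c d := by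
  obtain ⟨d, hd, h', -⟩ := exists_opposite (face_rotate h.1)
  exact ⟨d, (traverses_next_iff h.1 h' hd).2 h⟩

/-- A passage from `v` to `w` is determined by the face shared with the following edge, so counting
passages becomes counting apexes, of which there are two. -/
theorem mem_passages_iff {v w : V} {Z : S.ZigzagSeq} :
    Z ∈ passages τ v w ↔ ∃ t : S.Flag, t.a = v ∧ t.b = w ∧ Z = t.zigzag ∧ (⟦Z⟧ : S.Zigzag) ∈ τ := by
  constructor
  · rintro ⟨hτ, h0, -, hw⟩
    have hvw : v ≠ w := by
      rintro rfl
      have := (Z.2.isEdge 0).1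
      simp [h0] at this
    obtain ⟨x, hx, hxw⟩ := Finset.exists_mem_ne (s := Z.1 1) (by rw [(Z.2.isEdge 1).1]; simp) w
    have h1 : Z.1 1 = {w, x} := by
      refine (Finset.eq_of_subset_of_card_le (fun y hy => ?_) ?_).symm
      · simp only [Finset.mem_insert, Finset.mem_singleton] at hy
        rcases hy with rfl | rfl <;> assumption
      · rw [(Z.2.isEdge 1).1, Finset.card_pair hxw.symm]
    obtain ⟨hne, F, hF, k0, k1⟩ := Z.2.adj 0
    rw [zero_add] at hne k1
    rw [h0] at k0
    obtain ⟨y, rfl⟩ := face_eq_insert hF hvw (k0 (by simp)) (k0 (by simp))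
    have hxv : x ≠ v := by rintro rfl; exact hne (by rw [h0, h1, Finset.pair_comm])
    have hxy : x = y := by
      have := k1 hx
      simp only [Finset.mem_insert, Finset.mem_singleton] at this
      tauto
    subst hxy
    exact ⟨⟨v, w, x, hF⟩, rfl, rfl, ZigzagSeq.ext_of_eq h0 h1, hτ⟩
  · rintro ⟨t, rfl, rfl, rfl, h⟩
    exact ⟨h, rfl, t.mem_zigzag_neg_one, by simp [t.zigzag_one]⟩

theorem Flag.zigzag_ne {v w x y : V} (hx : {v, w, x} ∈ S.faces) (hy : {v, w, y} ∈ S.faces)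
    (hxy : x ≠ y) : (⟨v, w, x, hx⟩ : S.Flag).zigzag ≠ (⟨v, w, y, hy⟩ : S.Flag).zigzag := by
  intro e
  have := congrArg (fun Z => Z.1 1) e
  simp only [Flag.zigzag_one] at this
  have hm : x ∈ ({w, y} : Finset V) := by rw [← this]; simp
  have := (ne_of_face hx).2.1
  simp only [Finset.mem_insert, Finset.mem_singleton] at hm
  rcases hm with rfl | rfl <;> tauto

theorem exists_traverses_of_passages_nonempty {v w : V} (h : (passages τ v w).Nonempty) :
    ∃ x, Traverses τ v w x := by
  obtain ⟨Z, hZ⟩ := h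
  obtain ⟨⟨_, _, x, h⟩, rfl, rfl, rfl, hτ⟩ := mem_passages_iff.1 hZ
  exact ⟨x, h, hτ⟩

theorem Traverses.passages_nonempty {v w x : V} (h : Traverses τ v w x) :
    (passages τ v w).Nonempty :=
  ⟨_, mem_passages_iff.2 ⟨⟨v, w, x, h.1⟩, rfl, rfl, rfl, h.2⟩⟩

theorem passages_eq_empty_iff {v w : V} : passages τ v w = ∅ ↔ ∀ x, ¬ Traverses τ v w x := by
  rw [← not_exists, ← Set.not_nonempty_iff_eq_empty, not_iff_not]
  exact ⟨exists_traverses_of_passages_nonempty, fun ⟨_, h⟩ => h.passages_nonempty⟩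

theorem ncard_passages_eq_two {v w x y : V} (hx : Traverses τ v w x) (hy : Traverses τ v w y)
    (hxy : x ≠ y) : (passages τ v w).ncard = 2 := by
  rw [Set.ncard_eq_two]
  refine ⟨_, _, Flag.zigzag_ne hx.1 hy.1 hxy, Set.ext fun Z => ⟨fun hZ => ?_, ?_⟩⟩
  · obtain ⟨⟨_, _, z, h⟩, rfl, rfl, rfl, hτ⟩ := mem_passages_iff.1 hZ
    obtain ⟨o, -, -, hu⟩ := exists_opposite hx.1
    have hyo := (hu y hy.1).resolve_left hxy.symm
    subst hyo
    rcases hu z h with rfl | rfl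
    exacts [.inl rfl, .inr rfl]
  · rintro (rfl | rfl)
    · exact mem_passages_iff.2 ⟨_, rfl, rfl, rfl, hx.2⟩
    · exact mem_passages_iff.2 ⟨_, rfl, rfl, rfl, hy.2⟩

theorem ncard_passages_eq_one {v w x : V} (hx : Traverses τ v w x)
    (h : ∀ y, Traverses τ v w y → y = x) : (passages τ v w).ncard = 1 := by
  rw [Set.ncard_eq_one]
  refine ⟨(⟨v, w, x, hx.1⟩ : S.Flag).zigzag, Set.ext fun Z => ⟨fun hZ => ?_, ?_⟩⟩
  · obtain ⟨⟨_, _, z, hz⟩, rfl, rfl, rfl, hτ⟩ := mem_passages_iff.1 hZ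
    have := h z ⟨hz, hτ⟩
    subst this
    rfl
  · rintro rfl
    exact mem_passages_iff.2 ⟨_, rfl, rfl, rfl, hx.2⟩

/-- The two apexes `x`, `y` of an edge `vw` exchange their roles when the edge is passed in the
opposite direction. -/
theorem traverses_flip_iff (hτ : IsZOrientation τ) {v w x y : V} (hx : {v, w, x} ∈ S.faces)
    (hy : {v, w, y} ∈ S.faces) (hxy : x ≠ y) : Traverses τ w v x ↔ ¬ Traverses τ v w y := by
  rw [traverses_reverse_iff hτ (face_rotate (face_rotate hx)),
    traverses_next_iff (face_rotate (face_rotate hx)) hy hxy.symm]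

theorem edgeTypeII_of_traverses (hτ : IsZOrientation τ) {v w x y : V} (hx : Traverses τ v w x)
    (hy : Traverses τ v w y) (hxy : x ≠ y) : EdgeTypeII τ v w := by
  refine ⟨graph_adj_of_face hx.1, ncard_passages_eq_two hx hy hxy, passages_eq_empty_iff.2 ?_⟩
  intro z hz
  obtain ⟨o, -, -, hu⟩ := exists_opposite hx.1
  have hyo := (hu y hy.1).resolve_left hxy.symm
  subst hyo
  rcases hu z (face_swap hz.1) with rfl | rfl
  · exact (traverses_flip_iff hτ hx.1 hy.1 hxy).1 hz hy
  · exact (traverses_flip_iff hτ hy.1 hx.1 hxy.symm).1 hz hx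

/-- With apexes `x`, `y`, exactly one of `vwx`, `wvy` and one of `vwy`, `wvx` is traversed
(`traverses_flip_iff`). Hence every edge is of type I or II, and one traversed flag starting with
`vw` suffices for an arc. -/
theorem arcs_pos_iff (hτ : IsZOrientation τ) {v w : V} :
    0 < arcs τ v w ↔ ∃ x, Traverses τ v w x := by
  constructor
  · intro h
    apply exists_traverses_of_passages_nonempty
    unfold arcs at h
    split_ifs at h with h1 h2
    · exact Set.nonempty_of_ncard_ne_zero (by rw [h1.2.1]; simp)
    · exact Set.nonempty_of_ncard_ne_zero (by rw [h2.2.1]; simp)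
    · exact absurd h (lt_irrefl _)
  · rintro ⟨x, hx⟩
    suffices EdgeTypeI τ v w ∨ EdgeTypeII τ v w by
      unfold arcs
      split_ifs <;> simp_all
    obtain ⟨y, hyx, hy, hu⟩ := exists_opposite hx.1
    by_cases hty : Traverses τ v w y
    · exact .inr (edgeTypeII_of_traverses hτ hx hty hyx.symm)
    · refine .inl ⟨graph_adj_of_face hx.1, ncard_passages_eq_one hx fun z hz =>
        (hu z hz.1).resolve_right (by rintro rfl; exact hty hz),
        ncard_passages_eq_one ((traverses_flip_iff hτ hx.1 hy hyx.symm).2 hty) fun z hz =>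
        (hu z (face_swap hz.1)).resolve_right ?_⟩
      rintro rfl
      exact (traverses_flip_iff hτ hy hx.1 hyx).1 hz hx

theorem EdgeTypeII.arcs_eq_zero {v w : V} (hτ : IsZOrientation τ) (h : EdgeTypeII τ v w) :
    arcs τ w v = 0 := by
  by_contra hne
  obtain ⟨x, hx⟩ := (arcs_pos_iff hτ).1 (Nat.pos_of_ne_zero hne)
  exact passages_eq_empty_iff.1 h.2.2 x hx

theorem faceTypeII_of_traverses (hτ : IsZOrientation τ) {a b c : V} (h1 : Traverses τ a b c)
    (h2 : Traverses τ b c a) (h3 : Traverses τ c a b) : FaceTypeII τ {a, b, c} := by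
  -- The edge `uv` is passed once in `uvw` and once in the continuation `uvd` of `wuv` across it.
  have key : ∀ {u v w : V}, Traverses τ u v w → Traverses τ w u v → EdgeTypeII τ u v := by
    intro u v w h h'
    obtain ⟨d, hd, hf, -⟩ := exists_opposite h.1
    exact edgeTypeII_of_traverses hτ h ((traverses_next_iff h'.1 hf hd).2 h') hd.symm
  exact ⟨a, b, c, rfl, key h1 h3, key h2 h1, key h3 h2⟩

/-- A face that is not of type II has vertices `u`, `v`, `w` with directed cycles `u → v → w → u`
and `u → v → u`. -/
theorem faceTypeII_or_exists_cycles (hτ : IsZOrientation τ) {F : Finset V} (hF : F ∈ S.faces) :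
    FaceTypeII τ F ∨ ∃ u v w, 0 < arcs τ u v ∧ 0 < arcs τ v u ∧ 0 < arcs τ v w ∧
      0 < arcs τ w u := by
  -- One flag is traversed from each of the three reverse pairs of a face. Two of the eight choices
  -- are cyclic and give type II; the other six are this one up to renaming.
  have mixed : ∀ {a b c : V}, Traverses τ a b c → Traverses τ b c a → Traverses τ b a c →
      ∃ u v w, 0 < arcs τ u v ∧ 0 < arcs τ v u ∧ 0 < arcs τ v w ∧ 0 < arcs τ w u := by
    intro a b c h1 h2 h3
    exact ⟨a, b, c, (arcs_pos_iff hτ).2 ⟨_, h1⟩, (arcs_pos_iff hτ).2 ⟨_, h3⟩,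
      (arcs_pos_iff hτ).2 ⟨_, h2⟩, (arcs_pos_iff hτ).2 (exists_traverses_next h2)⟩
  obtain ⟨a, b, c, -, -, -, rfl⟩ := Finset.card_eq_three.1 (S.card_face F hF)
  have r1 := traverses_reverse_iff hτ hF
  have r2 := traverses_reverse_iff hτ (face_rotate hF)
  have r3 := traverses_reverse_iff hτ (face_rotate (face_rotate hF))
  by_cases h1 : Traverses τ a b c <;> by_cases h2 : Traverses τ b c a <;>
    by_cases h3 : Traverses τ c a b
  · exact .inl (faceTypeII_of_traverses hτ h1 h2 h3)
  · exact .inr (mixed h1 h2 (r3.2 h3))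
  · exact .inr (mixed h3 h1 (r2.2 h2))
  · exact .inr (mixed (r3.2 h3) (r2.2 h2) h1)
  · exact .inr (mixed h2 h3 (r1.2 h1))
  · exact .inr (mixed (r1.2 h1) (r3.2 h3) h2)
  · exact .inr (mixed (r2.2 h2) (r1.2 h1) h3)
  · have := faceTypeII_of_traverses hτ (r1.2 h1) (r3.2 h3) (r2.2 h2)
    rw [show ({c, b, a} : Finset V) = {a, b, c} by ext; simp; tauto] at this
    exact .inl this

end Passages

end SimplicialSurface

/-! ### Periods of irreducible chains -/

section Markov

variable {V : Type*} [Fintype V] [DecidableEq V] {P : Matrix V V ℝ}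

theorem Matrix.pow_add_apply_pos (hP : ∀ i j, 0 ≤ P i j) {m n : ℕ} {u v w : V}
    (h : 0 < (P ^ m) u v) (h' : 0 < (P ^ n) v w) : 0 < (P ^ (m + n)) u w := by
  rw [pow_add, Matrix.mul_apply]
  exact Finset.sum_pos' (fun i _ => mul_nonneg (Matrix.pow_apply_nonneg hP _ _ _)
    (Matrix.pow_apply_nonneg hP _ _ _)) ⟨v, Finset.mem_univ _, mul_pos h h'⟩

theorem Matrix.exists_of_pow_succ_apply_pos (hP : ∀ i j, 0 ≤ P i j) {n : ℕ} {u w : V}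
    (h : 0 < (P ^ (n + 1)) u w) : ∃ v, 0 < (P ^ n) u v ∧ 0 < P v w := by
  rw [pow_succ, Matrix.mul_apply] at h
  obtain ⟨v, -, hv⟩ := Finset.exists_lt_of_sum_lt (f := fun _ => (0 : ℝ)) (by simpa using h)
  have h1 := Matrix.pow_apply_nonneg hP n u v
  have h2 := hP v w
  exact ⟨v, h1.lt_of_ne' fun e => by simp [e] at hv, h2.lt_of_ne' fun e => by simp [e] at hv⟩

/-- An irreducible chain with directed cycles of lengths two and three through a common state is
aperiodic. -/
theorem period_eq_one (hP : P.IsIrreducible) {u v w : V} (h1 : 0 < P u v) (h2 : 0 < P v u)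
    (h3 : 0 < P v w) (h4 : 0 < P w u) (x : V) : period P x = 1 := by
  have h0 := hP.nonneg
  obtain ⟨m, -, hm⟩ := (Matrix.isIrreducible_iff_exists_pow_pos h0).1 hP x u
  obtain ⟨n, -, hn⟩ := (Matrix.isIrreducible_iff_exists_pow_pos h0).1 hP u x
  rw [← pow_one P] at h1 h2 h3 h4
  have c2 := Matrix.pow_add_apply_pos h0 h1 h2
  have c3 := Matrix.pow_add_apply_pos h0 (Matrix.pow_add_apply_pos h0 h1 h3) h4
  have dvd : ∀ {k : ℕ}, 0 < (P ^ k) x x → period P x ∣ k := fun hk =>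
    Nat.setGcd_dvd_of_mem (s := {n : ℕ | 0 < (P ^ n) x x}) hk
  -- Walks from `x` to `u` and back, with no detour, a 2-cycle or a 3-cycle at `u`: the period
  -- divides `m + n`, `m + n + 2` and `m + n + 3`.
  have d0 := dvd (Matrix.pow_add_apply_pos h0 hm hn)
  have d2 := dvd (Matrix.pow_add_apply_pos h0 hm (Matrix.pow_add_apply_pos h0 c2 hn))
  have d3 := dvd (Matrix.pow_add_apply_pos h0 hm (Matrix.pow_add_apply_pos h0 c3 hn))
  rw [show m + (1 + 1 + n) = m + n + 2 by ring] at d2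
  rw [show m + (1 + 1 + 1 + n) = m + n + 3 by ring] at d3
  have e2 := (Nat.dvd_add_right d0).1 d2
  have e3 := (Nat.dvd_add_right d0).1 d3
  exact Nat.dvd_one.1 ((Nat.dvd_add_right e2).1 (show _ ∣ 2 + 1 from e3))

/-- The period divides 3, so it is 3. The label of `v` is the length modulo 3 of a walk from `x` to
`v`; two walks to the same vertex, closed by a common return walk, have congruent lengths. -/
theorem exists_cyclic_labelling (hP : P.IsIrreducible) (h3 : ∀ v, 0 < (P ^ 3) v v) {x : V}
    (hx : period P x ≠ 1) : ∃ f : V → ZMod 3, ∀ v w, 0 < P v w → f w = f v + 1 := by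
  have h0 := hP.nonneg
  have hirr := (Matrix.isIrreducible_iff_exists_pow_pos h0).1 hP
  have dvd : ∀ {k : ℕ}, 0 < (P ^ k) x x → period P x ∣ k := fun hk =>
    Nat.setGcd_dvd_of_mem (s := {n : ℕ | 0 < (P ^ n) x x}) hk
  have hd : period P x = 3 := ((Nat.dvd_prime Nat.prime_three).1 (dvd (h3 x))).resolve_left hx
  simp only [hd] at dvd
  choose m _ hm using hirr x
  refine ⟨fun v => m v, fun v w hvw => ?_⟩
  obtain ⟨k, -, hk⟩ := hirr w x
  have d1 := dvd (Matrix.pow_add_apply_pos h0 (hm w) hk)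
  rw [← pow_one P] at hvw
  have d2 := dvd (Matrix.pow_add_apply_pos h0 (Matrix.pow_add_apply_pos h0 (hm v) hvw) hk)
  rw [← ZMod.natCast_eq_zero_iff] at d1 d2
  push_cast at d1 d2
  exact add_right_cancel (d1.trans d2.symm)

/-- A walk of length `n` raises the label by `n`, so 3 divides the length of every closed walk. -/
theorem period_ne_one (hP : ∀ i j, 0 ≤ P i j) {f : V → ZMod 3}
    (hf : ∀ v w, 0 < P v w → f w = f v + 1) (x : V) : period P x ≠ 1 := by
  have key : ∀ (n : ℕ) (w : V), 0 < (P ^ n) x w → f w = f x + n := by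
    intro n
    induction n with
    | zero =>
      intro w hw
      by_cases hxw : x = w
      · simp [hxw]
      · simp [Matrix.one_apply_ne hxw] at hw
    | succ n ih =>
      intro w hw
      obtain ⟨v, hv, hvw⟩ := Matrix.exists_of_pow_succ_apply_pos hP hw
      rw [hf v w hvw, ih v hv]
      push_cast
      ring
  have h3 : 3 ∣ period P x := Nat.dvd_setGcd_iff.2 fun n hn => by
    have := key n x hn
    rwa [left_eq_add, ZMod.natCast_eq_zero_iff] at this
  intro h
  rw [h] at h3
  omega

end Markov

/-! ### Irreducibility, ergodicity and 3-colorings -/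

namespace SimplicialSurface

variable {V : Type*} [Fintype V] [DecidableEq V] {S : SimplicialSurface V} {τ : Set S.Zigzag}

theorem transitionMatrix_nonneg (v w : V) : 0 ≤ transitionMatrix τ v w := by
  unfold transitionMatrix
  positivity

theorem transitionMatrix_pos_iff {v w : V} : 0 < transitionMatrix τ v w ↔ 0 < arcs τ v w := by
  unfold transitionMatrix
  constructor
  · intro h
    by_contra hn
    have : arcs τ v w = 0 := by omega
    simp [this] at h
  · intro h
    have h' : (0 : ℝ) < arcs τ v w := by exact_mod_cast h
    exact div_pos h' (Finset.sum_pos' (fun _ _ => by positivity) ⟨w, Finset.mem_univ _, h'⟩)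

/-- A zigzag of `τ` through the arc follows arcs and closes up, since `step` has finite order. -/
theorem exists_path_back (hτ : IsZOrientation τ) {v w : V} (h : 0 < arcs τ v w) :
    Relation.ReflTransGen (fun v w => 0 < arcs τ v w) w v := by
  obtain ⟨x, hf, hx⟩ := (arcs_pos_iff hτ).1 h
  have key : ∀ (n : ℕ) (t : S.Flag), (⟦t.zigzag⟧ : S.Zigzag) ∈ τ →
      Relation.ReflTransGen (fun v w => 0 < arcs τ v w) t.a ((step ^ n) t).a := by
    intro n
    induction n with
    | zero => intro t _; exact .refl
    | succ n ih =>
      intro t ht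
      rw [pow_succ, Equiv.Perm.mul_apply, step_apply]
      exact .head ((arcs_pos_iff hτ).2 ⟨t.c, t.mem, ht⟩) (ih _ (by rwa [Flag.mk_zigzag_next]))
  obtain ⟨n, hn⟩ : ∃ n, orderOf (step : Equiv.Perm S.Flag) = n + 1 :=
    ⟨_, (Nat.succ_pred_eq_of_pos (orderOf_pos _)).symm⟩
  have := key n (⟨v, w, x, hf⟩ : S.Flag).next (by rwa [Flag.mk_zigzag_next])
  rwa [← step_apply, ← Equiv.Perm.mul_apply, ← pow_succ, ← hn, pow_orderOf_eq_one] at this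

theorem arcs_pos_or (hτ : IsZOrientation τ) {v w : V} (h : S.graph.Adj v w) :
    0 < arcs τ v w ∨ 0 < arcs τ w v := by
  obtain ⟨x, hx⟩ := exists_face_of_adj h
  obtain ⟨y, hyx, hy, -⟩ := exists_opposite hx
  by_cases ht : Traverses τ v w x
  · exact .inl ((arcs_pos_iff hτ).2 ⟨x, ht⟩)
  · exact .inr ((arcs_pos_iff hτ).2 ⟨y, (traverses_flip_iff hτ hy hx hyx).2 ht⟩)

theorem adj_of_arcs_pos (hτ : IsZOrientation τ) {v w : V} (h : 0 < arcs τ v w) :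
    S.graph.Adj v w := by
  obtain ⟨x, hx, -⟩ := (arcs_pos_iff hτ).1 h
  exact graph_adj_of_face hx

theorem isIrreducible_transitionMatrix (hτ : IsZOrientation τ) :
    (transitionMatrix τ).IsIrreducible := by
  have h0 : ∀ v w, 0 ≤ transitionMatrix τ v w := transitionMatrix_nonneg
  rw [Matrix.isIrreducible_iff_exists_pow_pos h0]
  have reach : ∀ {v w}, Relation.ReflTransGen (fun v w => 0 < arcs τ v w) v w →
      ∃ n, 0 < (transitionMatrix τ ^ n) v w := by
    intro v w h
    induction h with
    | refl => exact ⟨0, by simp⟩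
    | tail _ h ih =>
      obtain ⟨n, hn⟩ := ih
      exact ⟨n + 1, Matrix.pow_add_apply_pos h0 hn (by rwa [pow_one, transitionMatrix_pos_iff])⟩
  have conn : ∀ v w, Relation.ReflTransGen (fun v w => 0 < arcs τ v w) v w := by
    intro v w
    obtain ⟨p⟩ := S.connected.preconnected v w
    induction p with
    | nil => exact .refl
    | cons h _ ih =>
      rcases arcs_pos_or hτ h with h | h
      · exact .head h ih
      · exact (exists_path_back hτ h).trans ih
  intro v w
  obtain ⟨F, hF, hv⟩ := S.exists_face v
  obtain ⟨u, hu, huv⟩ := Finset.exists_mem_ne (by rw [S.card_face F hF]; simp) v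
  have hadj : S.graph.Adj v u := ⟨huv.symm, F, hF, hv, hu⟩
  -- Irreducibility asks for walks of positive length, also when `w = v`, so a first arc out of `v`
  -- is split off.
  obtain ⟨a, ha⟩ : ∃ a, 0 < arcs τ v a := by
    rcases arcs_pos_or hτ hadj with h | h
    · exact ⟨u, h⟩
    · rcases (exists_path_back hτ h).cases_head with e | ⟨a, ha, -⟩
      · exact absurd e.symm huv
      · exact ⟨a, ha⟩
  obtain ⟨n, hn⟩ := reach (conn a w)
  exact ⟨1 + n, by omega,
    Matrix.pow_add_apply_pos h0 (by rwa [pow_one, transitionMatrix_pos_iff]) hn⟩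

theorem not_isErgodicChain_iff (hτ : IsZOrientation τ) :
    ¬ IsErgodicChain (transitionMatrix τ) ↔ (∀ F ∈ S.faces, FaceTypeII τ F) ∧
      ∃ f : V → ZMod 3, ∀ v w, 0 < arcs τ v w → f w = f v + 1 := by
  have hirr := isIrreducible_transitionMatrix hτ
  have h0 : ∀ v w, 0 ≤ transitionMatrix τ v w := transitionMatrix_nonneg
  constructor
  · intro h
    have hall : ∀ F ∈ S.faces, FaceTypeII τ F := by
      intro F hF
      refine (faceTypeII_or_exists_cycles hτ hF).resolve_right ?_
      rintro ⟨u, v, w, h1, h2, h3, h4⟩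
      simp only [← transitionMatrix_pos_iff] at h1 h2 h3 h4
      exact h ⟨hirr, period_eq_one hirr h1 h2 h3 h4⟩
    refine ⟨hall, ?_⟩
    obtain ⟨x, hx⟩ : ∃ x, period (transitionMatrix τ) x ≠ 1 := by
      by_contra hn
      push Not at hn
      exact h ⟨hirr, hn⟩
    have h3 : ∀ v, 0 < (transitionMatrix τ ^ 3) v v := by
      intro v
      obtain ⟨F, hF, hv⟩ := S.exists_face v
      obtain ⟨a, b, c, rfl, hab, hbc, hca⟩ := hall F hF
      have kab := hab.arcs_pos
      have kbc := hbc.arcs_pos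
      have kca := hca.arcs_pos
      simp only [← transitionMatrix_pos_iff] at kab kbc kca
      rw [← pow_one (transitionMatrix τ)] at kab kbc kca
      simp only [Finset.mem_insert, Finset.mem_singleton] at hv
      rcases hv with rfl | rfl | rfl
      · exact Matrix.pow_add_apply_pos h0 (Matrix.pow_add_apply_pos h0 kab kbc) kca
      · exact Matrix.pow_add_apply_pos h0 (Matrix.pow_add_apply_pos h0 kbc kca) kab
      · exact Matrix.pow_add_apply_pos h0 (Matrix.pow_add_apply_pos h0 kca kab) kbc
    obtain ⟨f, hf⟩ := exists_cyclic_labelling hirr h3 hx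
    exact ⟨f, fun v w h => hf v w (transitionMatrix_pos_iff.2 h)⟩
  · rintro ⟨-, f, hf⟩ h
    obtain ⟨x⟩ := S.connected.nonempty
    exact period_ne_one h0 (fun v w h => hf v w (transitionMatrix_pos_iff.1 h)) x (h.2 x)

theorem colorable_of_labelling (hτ : IsZOrientation τ) {f : V → ZMod 3}
    (hf : ∀ v w, 0 < arcs τ v w → f w = f v + 1) : S.graph.Colorable 3 := by
  refine ⟨SimpleGraph.Coloring.mk (α := Fin 3) f fun {v w} h e => ?_⟩
  have e' : f v = f w := e
  rcases arcs_pos_or hτ h with h | h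
  · have := hf _ _ h
    rw [e', left_eq_add] at this
    exact absurd this (by decide)
  · have := hf _ _ h
    rw [e', left_eq_add] at this
    exact absurd this (by decide)

theorem exists_labelling_of_colorable (hτ : IsZOrientation τ) (h : ∀ F ∈ S.faces, FaceTypeII τ F)
    (hc : S.graph.Colorable 3) : ∃ f : V → ZMod 3, ∀ v w, 0 < arcs τ v w → f w = f v + 1 := by
  obtain ⟨C⟩ := hc
  let g : V → ZMod 3 := fun v => C v
  have hg : ∀ {v w}, S.graph.Adj v w → g v ≠ g w := fun h => C.valid h
  have third : ∀ p q r : ZMod 3, p ≠ q → q ≠ r → r ≠ p → r - q = q - p ∧ p - r = q - p := by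
    decide
  have unit : ∀ p q : ZMod 3, p ≠ q → q - p = 1 ∨ q - p = -1 := by decide
  -- One arc of a face of type II fixes the direction of its cycle, and three distinct colors in
  -- `ZMod 3` advance by a constant step around it.
  have cyc : ∀ {a b c : V}, {a, b, c} ∈ S.faces → 0 < arcs τ a b →
      0 < arcs τ b c ∧ 0 < arcs τ c a ∧ arcs τ b a = 0 ∧ arcs τ a c = 0 ∧
        g c - g b = g b - g a ∧ g a - g c = g b - g a := by
    intro a b c hf hab
    have col := third (g a) (g b) (g c) (hg (graph_adj_of_face hf))
      (hg (graph_adj_of_face (face_rotate hf)))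
      (hg (graph_adj_of_face (face_rotate (face_rotate hf))))
    refine ⟨?_, ?_, ?_, ?_, col⟩ <;> obtain ⟨x, y, z, e, h1, h2, h3⟩ := h _ hf <;>
    · have z1 := h1.arcs_eq_zero hτ
      have z2 := h2.arcs_eq_zero hτ
      have z3 := h3.arcs_eq_zero hτ
      have p1 := h1.arcs_pos
      have p2 := h2.arcs_pos
      have p3 := h3.arcs_pos
      have ha : a ∈ ({x, y, z} : Finset V) := by rw [← e]; simp
      have hb : b ∈ ({x, y, z} : Finset V) := by rw [← e]; simp
      have hc : c ∈ ({x, y, z} : Finset V) := by rw [← e]; simp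
      obtain ⟨n1, n2, n3⟩ := ne_of_face hf
      simp only [Finset.mem_insert, Finset.mem_singleton] at ha hb hc
      rcases ha with rfl | rfl | rfl <;> rcases hb with rfl | rfl | rfl <;>
        rcases hc with rfl | rfl | rfl <;> first | assumption | omega | tauto
  -- The change of color along the edge `vx`, taken in the direction of its arc. It agrees on the
  -- edges of a face at a vertex, hence around links and then on the whole connected graph.
  let D : V → V → ZMod 3 := fun v x => if 0 < arcs τ v x then g x - g v else g v - g x
  have pos : ∀ {v x}, 0 < arcs τ v x → D v x = g x - g v := fun h => if_pos h
  have neg : ∀ {v x}, arcs τ v x = 0 → D v x = g v - g x := fun h => if_neg (by omega)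
  have Dlink : ∀ {v x y}, {v, x, y} ∈ S.faces → D v x = D v y := by
    intro v x y hf
    rcases arcs_pos_or hτ (graph_adj_of_face hf) with hvx | hxv
    · obtain ⟨-, -, -, h4, -, h6⟩ := cyc hf hvx
      rw [pos hvx, neg h4, h6]
    · obtain ⟨h1, -, h3, -, h5, -⟩ := cyc (face_swap hf) hxv
      rw [neg h3, pos h1, h5]
  have Dvertex : ∀ {v x y}, S.graph.Adj v x → S.graph.Adj v y → D v x = D v y := by
    intro v x y hx hy
    obtain ⟨p⟩ := S.link_connected v x y hx hy
    clear hx hy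
    induction p with
    | nil => rfl
    | cons h _ ih => exact (Dlink h.2).trans ih
  have Dsymm : ∀ {v w}, S.graph.Adj v w → D v w = D w v := by
    have aux : ∀ {v w}, 0 < arcs τ v w → D v w = D w v := by
      intro v w h
      obtain ⟨x, hx⟩ := exists_face_of_adj (adj_of_arcs_pos hτ h)
      rw [pos h, neg (cyc hx h).2.2.1]
    intro v w h
    exact (arcs_pos_or hτ h).elim aux fun h => (aux h).symm
  have Dconst : ∀ {v x w y}, S.graph.Adj v x → S.graph.Adj w y → D v x = D w y := by
    intro v x w y hx hy
    obtain ⟨p⟩ := S.connected.preconnected v w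
    induction p generalizing x with
    | nil => exact Dvertex hx hy
    | cons h _ ih => rw [Dvertex hx h, Dsymm h]; exact ih h.symm hy
  obtain ⟨v₀⟩ := S.connected.nonempty
  obtain ⟨F, hF, -⟩ := S.exists_face v₀
  obtain ⟨a, b, c, rfl, hab, -⟩ := h F hF
  have hne := hg hab.1
  rcases unit _ _ hne with e | e
  · refine ⟨g, fun v w hvw => ?_⟩
    rw [← e, ← pos hab.arcs_pos, ← Dconst (adj_of_arcs_pos hτ hvw) hab.1, pos hvw]
    ring
  · refine ⟨fun v => - g v, fun v w hvw => ?_⟩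
    have : g w - g v = -1 := by
      rw [← e, ← pos hab.arcs_pos, ← Dconst (adj_of_arcs_pos hτ hvw) hab.1, pos hvw]
    linear_combination -this

end SimplicialSurface

open Set Topology

/-! ### Vanishing of first Čech cohomology on the sphere and the projective plane -/

section Cech

variable {ι X Y G : Type*} [TopologicalSpace X] [TopologicalSpace Y] [AddCommGroup G]

/-- A Čech cocycle with constant coefficients for an open cover. -/
structure IsCechCocycle (U : ι → Set X) (c : ι → ι → G) : Prop where
  isOpen : ∀ i, IsOpen (U i)
  cover : ∀ x, ∃ i, x ∈ U i
  add : ∀ x i j k, x ∈ U i → x ∈ U j → x ∈ U k → c i j + c j k = c i k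

variable {U : ι → Set X} {c : ι → ι → G}

theorem IsCechCocycle.self (h : IsCechCocycle U c) {x : X} {i : ι} (hx : x ∈ U i) : c i i = 0 := by
  simpa using h.add x i i i hx hx hx

theorem IsCechCocycle.preimage (h : IsCechCocycle U c) {f : Y → X} (hf : Continuous f) :
    IsCechCocycle (fun i => f ⁻¹' U i) c :=
  ⟨fun i => (h.isOpen i).preimage hf, fun x => h.cover (f x), fun x => h.add (f x)⟩

variable [TopologicalSpace G]

/-- The restriction to `s` of the cocycle `c` is the coboundary of locally constant functions. -/
def CechTrivialOn (U : ι → Set X) (c : ι → ι → G) (s : Set X) : Prop :=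
  ∃ σ : ι → X → G, (∀ i, ContinuousOn (σ i) (s ∩ U i)) ∧
    ∀ i j, ∀ x ∈ s, x ∈ U i → x ∈ U j → σ j x = σ i x + c i j

theorem IsCechCocycle.continuousOn_of_eq (h : IsCechCocycle U c) {s : Set X} {d : X → G}
    {D : ι → X → G} (hD : ∀ i, ContinuousOn (D i) (s ∩ U i))
    (hd : ∀ i, ∀ x ∈ s, x ∈ U i → d x = D i x) : ContinuousOn d s := by
  intro x hx
  obtain ⟨i, hi⟩ := h.cover x
  have : ContinuousWithinAt d (s ∩ U i) x :=
    ((hD i) x ⟨hx, hi⟩).congr (fun y hy => hd i y hy.1 hy.2) (hd i x hx hi)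
  rwa [continuousWithinAt_inter ((h.isOpen i).mem_nhds hi)] at this

variable [DiscreteTopology G]

/-- The bundle of which the sections trivialize the cocycle. -/
noncomputable def IsCechCocycle.bundleCore (h : IsCechCocycle U c) : FiberBundleCore ι X G where
  baseSet := U
  isOpen_baseSet := h.isOpen
  indexAt x := (h.cover x).choose
  mem_baseSet_at x := (h.cover x).choose_spec
  coordChange i j _ g := g + c i j
  coordChange_self i x hx g := by rw [h.self hx, add_zero]
  continuousOn_coordChange i j :=
    ((continuous_of_discreteTopology (f := fun g : G => g + c i j)).comp
      continuous_snd).continuousOn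
  coordChange_comp i j k x hx g := by rw [add_assoc, h.add x i j k hx.1.1 hx.1.2 hx.2]

/-- The cocycle glues a covering space with fiber `G`. Lifting the identity gives a global section,
whose coordinates in the local trivializations are the required functions. -/
theorem IsCechCocycle.trivialOn_univ [SimplyConnectedSpace X] [LocallyPathConnectedSpace X]
    (h : IsCechCocycle U c) : CechTrivialOn U c univ := by
  let Z := h.bundleCore
  have cov : IsCoveringMap (Bundle.TotalSpace.proj : Z.TotalSpace → X) :=
    FiberBundle.isCoveringMap
  obtain ⟨x₀⟩ := (inferInstance : Nonempty X)
  obtain ⟨s, ⟨-, hs⟩, -⟩ :=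
    cov.existsUnique_continuousMap_lifts (ContinuousMap.id X) x₀ ⟨x₀, (0 : G)⟩ rfl
  have hs' : ∀ x, (s x).1 = x := fun x => congrFun hs x
  refine ⟨fun i x => (Z.localTriv i (s x)).2, fun i => ?_, fun i j x _ hi hj => ?_⟩
  · refine continuous_snd.comp_continuousOn
      ((Z.localTriv i).continuousOn_toFun.comp s.continuous.continuousOn fun x hx => ?_)
    change (s x).1 ∈ U i
    rw [hs']
    exact hx.2
  · simp only [FiberBundleCore.localTriv_apply]
    have hix : x ∈ U (Z.indexAt (s x).1) := by
      have := Z.mem_baseSet_at (s x).1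
      rwa [hs'] at this ⊢
    change (show G from (s x).2) + c _ j = (show G from (s x).2) + c _ i + c i j
    rw [add_assoc, h.add x _ _ _ hix hi hj]

theorem IsCechCocycle.trivialOn_source [SimplyConnectedSpace Y] [LocallyPathConnectedSpace Y]
    (h : IsCechCocycle U c) (e : OpenPartialHomeomorph X Y) (he : e.target = univ) :
    CechTrivialOn U c e.source := by
  have hc : Continuous e.symm := by
    rw [← continuousOn_univ, ← he]
    exact e.continuousOn_symm
  obtain ⟨σ, hσ, hσ'⟩ := (h.preimage hc).trivialOn_univ
  refine ⟨fun i x => σ i (e x), fun i => ?_, fun i j x hx hi hj => ?_⟩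
  · refine (hσ i).comp (e.continuousOn.mono inter_subset_left) fun x hx => ⟨mem_univ _, ?_⟩
    change e.symm (e x) ∈ U i
    rw [e.left_inv hx.1]
    exact hx.2
  · refine hσ' i j (e x) (mem_univ _) ?_ ?_
    · change e.symm (e x) ∈ U i
      rwa [e.left_inv hx]
    · change e.symm (e x) ∈ U j
      rwa [e.left_inv hx]

/-- On the overlap the two trivializations differ by a locally constant function that does not
depend on the index. It is a constant `k`, by which the first one is corrected. -/
theorem CechTrivialOn.union {s t : Set X} (h : IsCechCocycle U c) (hs : IsOpen s) (ht : IsOpen t)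
    (hst : IsPreconnected (s ∩ t)) (h₁ : CechTrivialOn U c s) (h₂ : CechTrivialOn U c t) :
    CechTrivialOn U c (s ∪ t) := by
  classical
  obtain ⟨σ, hσ, hσ'⟩ := h₁
  obtain ⟨ρ, hρ, hρ'⟩ := h₂
  obtain ⟨k, hk⟩ : ∃ k : G, ∀ i, ∀ x ∈ s ∩ t, x ∈ U i → ρ i x = σ i x + k := by
    let d : X → G := fun x => ρ (h.cover x).choose x - σ (h.cover x).choose x
    have hd : ∀ i, ∀ x ∈ s ∩ t, x ∈ U i → d x = ρ i x - σ i x := by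
      intro i x hx hi
      have hj := (h.cover x).choose_spec
      simp only [d]
      rw [hσ' _ i x hx.1 hj hi, hρ' _ i x hx.2 hj hi]
      abel
    have hcont : ContinuousOn d (s ∩ t) := h.continuousOn_of_eq
      (fun i => ((hρ i).mono fun x hx => ⟨hx.1.2, hx.2⟩).sub
        ((hσ i).mono fun x hx => ⟨hx.1.1, hx.2⟩)) hd
    rcases (s ∩ t).eq_empty_or_nonempty with he | ⟨y, hy⟩
    · exact ⟨0, fun i x hx => by simp [he] at hx⟩
    · refine ⟨d y, fun i x hx hi => ?_⟩
      rw [← hst.constant hcont hx hy, hd i x hx hi]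
      abel
  have hρt : ∀ i, ∀ x ∈ t, x ∈ U i → (if x ∈ s then σ i x + k else ρ i x) = ρ i x := by
    intro i x hx hi
    split_ifs with hxs
    · exact (hk i x ⟨hxs, hx⟩ hi).symm
    · rfl
  refine ⟨fun i x => if x ∈ s then σ i x + k else ρ i x, fun i x hx => ?_,
    fun i j x hx hi hj => ?_⟩
  · refine ContinuousAt.continuousWithinAt ?_
    rcases hx.1 with hxs | hxt
    · have hc : ContinuousOn (fun x => σ i x + k) (s ∩ U i) := (hσ i).add continuousOn_const
      have hn : s ∩ U i ∈ 𝓝 x := (hs.inter (h.isOpen i)).mem_nhds ⟨hxs, hx.2⟩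
      exact (hc.congr fun y hy => if_pos hy.1).continuousAt hn
    · have hn : t ∩ U i ∈ 𝓝 x := (ht.inter (h.isOpen i)).mem_nhds ⟨hxt, hx.2⟩
      exact ((hρ i).congr fun y hy => hρt i y hy.1 hy.2).continuousAt hn
  · rcases hx with hxs | hxt
    · simp only [if_pos hxs]
      rw [hσ' i j x hxs hi hj]
      abel
    · simp only [hρt i x hxt hi, hρt j x hxt hj]
      exact hρ' i j x hxt hi hj

theorem IsCechCocycle.trivialOn_twoSphere {U : ι → Set TwoSphere} (h : IsCechCocycle U c) :
    CechTrivialOn U c univ := by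
  have rank : Module.finrank ℝ (EuclideanSpace ℝ (Fin 3)) = 2 + 1 := by simp
  obtain ⟨v⟩ : Nonempty TwoSphere := (NormedSpace.sphere_nonempty.2 zero_le_one).to_subtype
  have hv : ‖(v : EuclideanSpace ℝ (Fin 3))‖ = 1 := norm_eq_of_mem_sphere v
  have hv' : ‖((-v : TwoSphere) : EuclideanSpace ℝ (Fin 3))‖ = 1 := norm_eq_of_mem_sphere (-v)
  have s₁ : (stereographic hv).source = {v}ᶜ := stereographic_source hv
  have s₂ : (stereographic hv').source = {-v}ᶜ := stereographic_source hv'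
  have hne : -v ≠ v := fun e => ne_neg_of_mem_unit_sphere ℝ v e.symm
  have t₁ := h.trivialOn_source (stereographic hv) (stereographic_target hv)
  have t₂ := h.trivialOn_source (stereographic hv') (stereographic_target hv')
  -- The overlap is the image under inverse stereographic projection of a plane without one point.
  have hpre : IsPreconnected ((stereographic hv).source ∩ (stereographic hv').source) := by
    have hfin : Fact (Module.finrank ℝ (EuclideanSpace ℝ (Fin 3)) = 2 + 1) := ⟨rank⟩
    have hr : 1 < Module.rank ℝ (ℝ ∙ (v : EuclideanSpace ℝ (Fin 3)))ᗮ := by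
      rw [← Module.finrank_eq_rank, Submodule.finrank_orthogonal_span_singleton (n := 2)
        (fun e => by rw [e, norm_zero] at hv; exact zero_ne_one hv)]
      norm_num
    have hcon :=
      (isConnected_compl_singleton_of_one_lt_rank hr (stereographic hv (-v))).isPreconnected
    have hc : Continuous (stereographic hv).symm := by
      rw [← continuousOn_univ, ← stereographic_target hv]
      exact (stereographic hv).continuousOn_symm
    convert hcon.image _ hc.continuousOn using 1
    have hm : -v ∈ (stereographic hv).source := by rw [s₁]; exact hne
    ext x
    simp only [s₂, mem_inter_iff, mem_compl_iff, mem_singleton_iff, mem_image]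
    constructor
    · rintro ⟨h1, h2⟩
      exact ⟨stereographic hv x, fun e => h2 ((stereographic hv).injOn h1 hm e),
        (stereographic hv).left_inv h1⟩
    · rintro ⟨y, hy, rfl⟩
      have hyt : y ∈ (stereographic hv).target := by rw [stereographic_target]; trivial
      exact ⟨(stereographic hv).map_target hyt, fun e => hy (by
        rw [← e, (stereographic hv).right_inv hyt])⟩
  have := CechTrivialOn.union h (stereographic hv).open_source (stereographic hv').open_source
    hpre t₁ t₂
  rwa [s₁, s₂, ← compl_inter, show ({v} ∩ {-v} : Set TwoSphere) = ∅ by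
    rw [singleton_inter_eq_empty]; exact hne.symm, compl_empty] at this

/-- A trivialization that is constant on the fibers of an open surjection descends to a coboundary
if the sets of the cover are connected. -/
theorem exists_coboundary_of_fiberwise {f : Y → X} (hf : IsOpenMap f) (hsurj : f.Surjective)
    (hU : ∀ i, IsPreconnected (U i)) (hne : ∀ i, (U i).Nonempty) {σ : ι → Y → G}
    (hopen : ∀ i, IsOpen (f ⁻¹' U i))
    (hσ : ∀ i, ContinuousOn (σ i) (f ⁻¹' U i))
    (hσ' : ∀ i j y, f y ∈ U i → f y ∈ U j → σ j y = σ i y + c i j)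
    (hfib : ∀ i y z, f y ∈ U i → f y = f z → σ i y = σ i z) :
    ∃ φ : ι → G, ∀ i j, (U i ∩ U j).Nonempty → φ j = φ i + c i j := by
  -- The section `g` need not be continuous, but `σ i ∘ g` is locally constant because `f` is open
  -- and `σ i` is constant on fibers.
  choose g hg using hsurj
  have hcont : ∀ i, ContinuousOn (fun x => σ i (g x)) (U i) := by
    intro i x hx
    refine ContinuousAt.continuousWithinAt ?_
    have hgx : g x ∈ f ⁻¹' U i := by change f (g x) ∈ U i; rwa [hg]
    have hev : ∀ᶠ y in 𝓝 (g x), f y ∈ U i ∧ σ i y = σ i (g x) := by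
      refine Filter.Eventually.and ((hopen i).mem_nhds hgx) ?_
      have := ((hσ i).continuousAt ((hopen i).mem_nhds hgx)).eventually
        ((isOpen_discrete {σ i (g x)}).mem_nhds rfl)
      exact this
    have him := hf.image_mem_nhds hev
    rw [hg] at him
    refine ContinuousAt.congr (f := fun _ => σ i (g x)) continuousAt_const ?_
    filter_upwards [him]
    rintro _ ⟨y, ⟨hy, hy'⟩, rfl⟩
    rw [← hy']
    exact hfib i y _ hy (hg _).symm
  choose b hb using hne
  refine ⟨fun i => σ i (g (b i)), fun i j ⟨x, hi, hj⟩ => ?_⟩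
  have e1 := (hU i).constant (hcont i) (hb i) hi
  have e2 := (hU j).constant (hcont j) (hb j) hj
  change σ i (g (b i)) = σ i (g x) at e1
  change σ j (g (b j)) = σ j (g x) at e2
  simp only [e1, e2]
  exact hσ' i j _ (by rwa [hg]) (by rwa [hg])

theorem IsCechCocycle.exists_coboundary_of_twoSphere (h : IsCechCocycle U c)
    (hU : ∀ i, IsPreconnected (U i)) (hne : ∀ i, (U i).Nonempty) (e : X ≃ₜ TwoSphere) :
    ∃ φ : ι → G, ∀ i j, (U i ∩ U j).Nonempty → φ j = φ i + c i j := by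
  have h' := h.preimage e.symm.continuous
  obtain ⟨σ, hσ, hσ'⟩ := h'.trivialOn_twoSphere
  simp only [univ_inter] at hσ
  exact exists_coboundary_of_fiberwise e.symm.isOpenMap e.symm.surjective hU hne h'.isOpen hσ
    (fun i j y => hσ' i j y (mem_univ _))
    fun i y z _ hyz => by rw [e.symm.injective hyz]

theorem isOpenMap_antipodal_mk :
    IsOpenMap (fun x : TwoSphere => (Quotient.mk antipodalSetoid x : ProjectivePlane)) := by
  intro s hs
  rw [← isQuotientMap_quotient_mk'.isOpen_preimage]
  have : (Quotient.mk antipodalSetoid) ⁻¹' ((Quotient.mk antipodalSetoid) '' s) =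
      s ∪ (fun x : TwoSphere => -x) ⁻¹' s := by
    ext x
    simp only [mem_preimage, mem_image, mem_union]
    constructor
    · rintro ⟨y, hy, hyx⟩
      rcases (Quotient.exact hyx : y = x ∨ y = -x) with rfl | rfl
      exacts [.inl hy, .inr hy]
    · rintro (hx | hx)
      · exact ⟨x, hx, rfl⟩
      · exact ⟨-x, hx, Quotient.sound (.inr rfl)⟩
  change IsOpen ((Quotient.mk antipodalSetoid) ⁻¹' ((Quotient.mk antipodalSetoid) '' s))
  rw [this]
  exact hs.union (hs.preimage continuous_neg)

theorem IsCechCocycle.exists_coboundary_of_projectivePlane (h : IsCechCocycle U c)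
    (hU : ∀ i, IsPreconnected (U i)) (hne : ∀ i, (U i).Nonempty) (hG : ∀ g : G, g = -g → g = 0)
    (e : X ≃ₜ ProjectivePlane) :
    ∃ φ : ι → G, ∀ i j, (U i ∩ U j).Nonempty → φ j = φ i + c i j := by
  let p : TwoSphere → X := fun x => e.symm (Quotient.mk antipodalSetoid x)
  have hp : Continuous p := e.symm.continuous.comp continuous_quotient_mk'
  have hneg : ∀ x, p (-x) = p x := fun x =>
    congrArg e.symm (Quotient.sound (s := antipodalSetoid) (.inr rfl))
  have h' := h.preimage hp
  obtain ⟨σ, hσ, hσ'⟩ := h'.trivialOn_twoSphere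
  simp only [univ_inter] at hσ
  -- The defect of antipodal invariance. It does not depend on the index, is constant by
  -- connectedness and changes sign under `x ↦ -x`, so it vanishes by `hG` and the trivialization
  -- descends.
  let d : TwoSphere → G := fun x => σ (h'.cover x).choose (-x) - σ (h'.cover x).choose x
  have hd : ∀ i x, p x ∈ U i → d x = σ i (-x) - σ i x := by
    intro i x hi
    have hj := (h'.cover x).choose_spec
    have hi' : p (-x) ∈ U i := by rwa [hneg]
    have hj' : p (-x) ∈ U (h'.cover x).choose := by rwa [hneg]
    simp only [d]
    rw [hσ' _ i x (mem_univ _) hj hi, hσ' _ i (-x) (mem_univ _) hj' hi']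
    abel
  have hcont : ContinuousOn d univ := by
    refine h'.continuousOn_of_eq (D := fun i x => σ i (-x) - σ i x) (fun i => ?_)
      fun i x _ => hd i x
    refine ContinuousOn.sub ((hσ i).comp continuous_neg.continuousOn fun x hx => ?_)
      ((hσ i).mono inter_subset_right)
    change p (-x) ∈ U i
    rw [hneg]
    exact hx.2
  have hconn : IsPreconnected (univ : Set TwoSphere) := by
    have : IsPreconnected (Metric.sphere (0 : EuclideanSpace ℝ (Fin 3)) 1) :=
      isPreconnected_sphere (by rw [← Module.finrank_eq_rank]; simp) _ _
    rwa [isPreconnected_iff_preconnectedSpace, preconnectedSpace_iff_univ] at this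
  have hzero : ∀ x, d x = 0 := by
    intro x
    obtain ⟨i, hi⟩ := h'.cover x
    have e1 := hconn.constant hcont (mem_univ x) (mem_univ (-x))
    have hi' : p (-x) ∈ U i := by rw [hneg]; exact hi
    refine hG _ ?_
    nth_rw 1 [e1]
    rw [hd i x hi, hd i (-x) hi', neg_neg, neg_sub]
  have hmk : (fun x : TwoSphere => (Quotient.mk antipodalSetoid x : ProjectivePlane)).Surjective :=
    Quotient.mk_surjective
  refine exists_coboundary_of_fiberwise (f := p) (e.symm.isOpenMap.comp isOpenMap_antipodal_mk)
    (e.symm.surjective.comp hmk) hU hne h'.isOpen hσ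
    (fun i j y => hσ' i j y (mem_univ _)) fun i y z hy hyz => ?_
  rcases (Quotient.exact (e.symm.injective hyz) : y = z ∨ y = -z) with rfl | rfl
  · rfl
  · rw [hneg] at hy
    exact sub_eq_zero.1 ((hd i z hy).symm.trans (hzero z))

end Cech

/-! ### The cover by open stars and the cocycle of the arcs -/

namespace SimplicialSurface

variable {V : Type*} [Fintype V] [DecidableEq V] {S : SimplicialSurface V} {τ : Set S.Zigzag}

variable (S) in
/-- The open star of a vertex in the geometric realization. -/
def openStar (v : V) : Set (realization S.faces) := {x | 0 < x.1 v}

theorem single_mem_realization (v : V) : Pi.single v 1 ∈ realization S.faces := by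
  obtain ⟨F, hF, hv⟩ := S.exists_face v
  refine ⟨fun w => ?_, by simp, F, hF, fun w hw => ?_⟩
  · by_cases h : w = v
    · subst h; simp
    · simp [h]
  · exact Pi.single_eq_of_ne (by rintro rfl; exact hw hv) _

theorem openStar_nonempty (v : V) : (openStar S v).Nonempty :=
  ⟨⟨_, single_mem_realization v⟩, by simp [openStar]⟩

/-- The star is star-convex about its vertex: the segment from the vertex to a point stays in a face
carrying that point. -/
theorem isPreconnected_openStar (v : V) : IsPreconnected (openStar S v) := by
  rw [← IsInducing.subtypeVal.isPreconnected_image]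
  have hv : (Pi.single v 1 : V → ℝ) ∈ Subtype.val '' openStar S v :=
    ⟨⟨_, single_mem_realization v⟩, by simp [openStar], rfl⟩
  refine (StarConvex.isPathConnected (a := Pi.single v 1) ?_ hv).isConnected.isPreconnected
  rintro _ ⟨⟨x, h0, h1, F, hF, hxF⟩, hx, rfl⟩ a b ha hb hab
  have hx' : 0 < x v := hx
  have hvF : v ∈ F := by
    by_contra h
    rw [hxF v h] at hx'
    exact lt_irrefl _ hx'
  have hs : ∀ w, 0 ≤ (Pi.single v 1 : V → ℝ) w := (single_mem_realization (S := S) v).1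
  refine ⟨⟨a • Pi.single v 1 + b • x, fun w => ?_, ?_, F, hF, fun w hw => ?_⟩, ?_, rfl⟩
  · exact add_nonneg (mul_nonneg ha (hs w)) (mul_nonneg hb (h0 w))
  · simp only [Pi.add_apply, Pi.smul_apply, smul_eq_mul, Finset.sum_add_distrib, ← Finset.mul_sum,
      h1, Finset.sum_pi_single', Finset.mem_univ, if_true]
    simpa using hab
  · have : w ≠ v := fun h => hw (h ▸ hvF)
    simp [hxF w hw, this]
  · change 0 < (a • Pi.single v 1 + b • x : V → ℝ) v
    simp only [Pi.add_apply, Pi.smul_apply, smul_eq_mul, Pi.single_eq_same, mul_one]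
    rcases ha.eq_or_lt with rfl | ha
    · have : b = 1 := by linarith
      simpa [this] using hx'
    · exact add_pos_of_pos_of_nonneg ha (mul_nonneg hb hx'.le)

theorem openStar_inter_nonempty {v w : V} (h : S.graph.Adj v w) :
    (openStar S v ∩ openStar S w).Nonempty := by
  obtain ⟨-, F, hF, hv, hw⟩ := h
  -- The barycenter of `F`.
  refine ⟨⟨fun u => if u ∈ F then 1 / 3 else 0, fun u => ?_, ?_, F, hF, fun u hu => if_neg hu⟩,
    ?_, ?_⟩
  · dsimp only
    split_ifs <;> norm_num
  · simp [S.card_face F hF]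
  · simp [openStar, hv]
  · simp [openStar, hw]

open Classical in
/-- The cochain with values modulo three that takes the value one on each directed edge. -/
noncomputable def arcCochain (τ : Set S.Zigzag) (v w : V) : ZMod 3 :=
  if 0 < arcs τ v w then 1 else if 0 < arcs τ w v then -1 else 0

theorem arcCochain_eq_sub (hτ : IsZOrientation τ) {F : Finset V} (hF : F ∈ S.faces)
    (h : FaceTypeII τ F) :
    ∃ k : V → ZMod 3, ∀ v ∈ F, ∀ w ∈ F, arcCochain τ v w = k w - k v := by
  obtain ⟨a, b, c, rfl, h1, h2, h3⟩ := h
  obtain ⟨n1, n2, n3⟩ := ne_of_face hF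
  have z1 := h1.arcs_eq_zero hτ
  have z2 := h2.arcs_eq_zero hτ
  have z3 := h3.arcs_eq_zero hτ
  have p1 := h1.arcs_pos
  have p2 := h2.arcs_pos
  have p3 := h3.arcs_pos
  have loop : ∀ v, arcs τ v v = 0 := fun v => by
    by_contra hne
    exact (adj_of_arcs_pos hτ (Nat.pos_of_ne_zero hne)).ne rfl
  have e1 : (1 : ZMod 3) = 2 - 1 := by decide
  have e2 : (-1 : ZMod 3) = 1 - 2 := by decide
  have e3 : (1 : ZMod 3) = 0 - 2 := by decide
  have e4 : (-1 : ZMod 3) = 2 - 0 := by decide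
  have k1 : b ≠ a := n1.symm
  have k2 : c ≠ b := n2.symm
  have k3 : c ≠ a := n3.symm
  -- Labels 0, 1, 2 along the cycle; the closing arc from 2 to 0 is again +1 modulo 3.
  refine ⟨fun t => if t = a then 0 else if t = b then 1 else 2, fun v hv w hw => ?_⟩
  simp only [Finset.mem_insert, Finset.mem_singleton] at hv hw
  unfold arcCochain
  rcases hv with rfl | rfl | rfl <;> rcases hw with rfl | rfl | rfl <;>
    simp only [loop, z1, z2, z3, p1, p2, p3, k1, k2, k3, lt_irrefl, if_true, if_false, sub_self,
      sub_zero, zero_sub] <;> decide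

/-- Stars with a common point have their vertices in the face carrying it, and there the cochain is
a coboundary. -/
theorem isCechCocycle_arcCochain (hτ : IsZOrientation τ) (h : ∀ F ∈ S.faces, FaceTypeII τ F) :
    IsCechCocycle (openStar S) (arcCochain τ) where
  isOpen v := isOpen_lt continuous_const ((continuous_apply v).comp continuous_subtype_val)
  cover x := by
    by_contra hn
    push Not at hn
    have h0 : ∀ v, x.1 v = 0 := fun v => le_antisymm (not_lt.1 (hn v)) (x.2.1 v)
    have := x.2.2.1
    simp [h0] at this
  add x u v w hu hv hw := by
    obtain ⟨F, hF, hxF⟩ := x.2.2.2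
    have mem : ∀ v, x ∈ openStar S v → v ∈ F := fun v hv => by
      by_contra hn
      exact hv.ne' (hxF v hn)
    obtain ⟨k, hk⟩ := arcCochain_eq_sub hτ hF (h F hF)
    rw [hk u (mem u hu) v (mem v hv), hk v (mem v hv) w (mem w hw), hk u (mem u hu) w (mem w hw)]
    ring

end SimplicialSurface

theorem Triangulation.exists_labelling {V : Type*} [Fintype V] [DecidableEq V] {M : Type*}
    [TopologicalSpace M] (Γ : Triangulation V M) {τ : Set Γ.toSimplicialSurface.Zigzag}
    (hτ : SimplicialSurface.IsZOrientation τ)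
    (hM : Nonempty (M ≃ₜ TwoSphere) ∨ Nonempty (M ≃ₜ ProjectivePlane))
    (h : ∀ F ∈ Γ.faces, SimplicialSurface.FaceTypeII τ F) :
    ∃ f : V → ZMod 3, ∀ v w, 0 < SimplicialSurface.arcs τ v w → f w = f v + 1 := by
  have hc := SimplicialSurface.isCechCocycle_arcCochain hτ h
  have hU := SimplicialSurface.isPreconnected_openStar (S := Γ.toSimplicialSurface)
  have hne := SimplicialSurface.openStar_nonempty (S := Γ.toSimplicialSurface)
  obtain ⟨f, hf⟩ : ∃ f : V → ZMod 3, ∀ v w,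
      (SimplicialSurface.openStar Γ.toSimplicialSurface v ∩
        SimplicialSurface.openStar Γ.toSimplicialSurface w).Nonempty →
      f w = f v + SimplicialSurface.arcCochain τ v w := by
    rcases hM with ⟨⟨e⟩⟩ | ⟨⟨e⟩⟩
    · exact hc.exists_coboundary_of_twoSphere hU hne (Γ.homeo.trans e)
    · exact hc.exists_coboundary_of_projectivePlane hU hne (by decide) (Γ.homeo.trans e)
  refine ⟨f, fun v w hvw => ?_⟩
  rw [hf v w (SimplicialSurface.openStar_inter_nonempty
    (SimplicialSurface.adj_of_arcs_pos hτ hvw)), SimplicialSurface.arcCochain, if_pos hvw]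

theorem theorem1 {V : Type*} [Fintype V] [DecidableEq V] {M : Type*} [TopologicalSpace M]
    (Γ : Triangulation V M) (τ : Set Γ.toSimplicialSurface.Zigzag)
    (hτ : SimplicialSurface.IsZOrientation τ) :
    (¬ IsErgodicChain (SimplicialSurface.transitionMatrix τ) ↔
      Γ.graph.Colorable 3 ∧ ∀ F ∈ Γ.faces, SimplicialSurface.FaceTypeII τ F) ∧
    (Nonempty (M ≃ₜ TwoSphere) ∨ Nonempty (M ≃ₜ ProjectivePlane) →
      (¬ IsErgodicChain (SimplicialSurface.transitionMatrix τ) ↔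
        ∀ F ∈ Γ.faces, SimplicialSurface.FaceTypeII τ F)) := by
  have key := SimplicialSurface.not_isErgodicChain_iff hτ
  refine ⟨key.trans ⟨?_, ?_⟩, fun hM => key.trans ⟨fun h => h.1, fun h => ⟨h, ?_⟩⟩⟩
  · rintro ⟨h, f, hf⟩
    exact ⟨SimplicialSurface.colorable_of_labelling hτ hf, h⟩
  · rintro ⟨hc, h⟩
    exact ⟨h, SimplicialSurface.exists_labelling_of_colorable hτ h hc⟩
  · exact Γ.exists_labelling hτ hM h
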